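/- Let $\kappa$ be an uncountable regular cardinal which is $\kappa$-compact, i.e. every $\kappa$-complete proper filter over $\kappa$ extends to a $\kappa$-complete ultrafilter over $\kappa$. For $X,Y\subseteq\kappa$ write $X\subseteq^* Y$ if $X\setminus Y$ is bounded in $\kappa$. Then there is a $\kappa$-complete uniform ultrafilter $U$ over $\kappa$ (uniform: $|X|=\kappa$ for every $X\in U$) such that: (1) $U$ is a $q$-point: every function $f:\kappa\to\kappa$ for which there is $X\in U$ with $|X\cap f^{-1}(\{\gamma\})|<\kappa$ for all $\gamma<\kappa$ is injective on some member of $U$; (2) $\neg\mathrm{Gal}^*(U,\kappa,2^\kappa)$ holds: there is a sequence $\langle A_i\mid i<2^\kappa\rangle$ of distinct members of $U$ such that for no $I\subseteq 2^\kappa$ with $|I|=\kappa$ is there an $X\in U$ with $X\subseteq^* A_i$ for all $i\in I$; (3) $(U,\supseteq^*)$ is Tukey-top, i.e. $(U,\supseteq^*)\equiv_T([2^\kappa]^{<\kappa},\subseteq)$. Here $[2^\kappa]^{<\kappa}$ is the set of subsets of $2^\kappa$ of cardinality less than $\kappa$; $P\le_T Q$ means that there is a map $Q\to P$ sending cofinal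 subsets of $Q$ to cofinal subsets of $P$; and $P\equiv_T Q$ means $P\le_T Q$ and $Q\le_T P$. -/

import Mathlib

open Cardinal Set

universe u

/-- The underlying set of the cardinal `κ`: the set of ordinals below `κ`, as a well-ordered type
of order type `κ`. -/
abbrev CardSet (κ : Cardinal.{u}) : Type u := κ.ord.ToType

/-- `X ⊆* Y`: the difference `X \ Y` is bounded. -/
def AlmostSubset {K : Type u} [LinearOrder K] (X Y : Set K) : Prop :=
  BddAbove (X \ Y)

/-- `μ` has the `κ`-filter extension property: every (proper) `μ`-complete filter over `κ` extends
to a `μ`-complete ultrafilter over `κ`. -/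
def HasFilterExtension (μ κ : Cardinal.{u}) : Prop :=
  ∀ F : Filter (CardSet κ), F.NeBot → CardinalInterFilter F μ →
    ∃ U : Ultrafilter (CardSet κ), (U : Filter (CardSet κ)) ≤ F ∧
      CardinalInterFilter (U : Filter (CardSet κ)) μ

/-- `κ` is `κ`-compact. -/
def IsSelfCompact (κ : Cardinal.{u}) : Prop :=
  HasFilterExtension κ κ

/-- Every member of the ultrafilter `U` over `κ` has cardinality `κ`. -/
def IsUniformUltrafilter {κ : Cardinal.{u}} (U : Ultrafilter (CardSet κ)) : Prop :=
  ∀ X ∈ U, #X = κ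

/-- `f` is almost one-to-one modulo `U`: on some member of `U` all its fibres have cardinality
less than `κ`. -/
def AlmostInjectiveMod {κ : Cardinal.{u}} (U : Ultrafilter (CardSet κ))
    (f : CardSet κ → CardSet κ) : Prop :=
  ∃ X ∈ U, ∀ c : CardSet κ, #(X ∩ f ⁻¹' {c} : Set (CardSet κ)) < κ

/-- `f` is injective modulo `U`. -/
def InjectiveMod {κ : Cardinal.{u}} (U : Ultrafilter (CardSet κ))
    (f : CardSet κ → CardSet κ) : Prop :=
  ∃ X ∈ U, InjOn f X

/-- `U` is a q-point. -/
def IsQPoint {κ : Cardinal.{u}} (U : Ultrafilter (CardSet κ)) : Prop :=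
  ∀ f : CardSet κ → CardSet κ, AlmostInjectiveMod U f → InjectiveMod U f

/-- `Gal*(U, μ, ν)`: among any `ν` (distinct) members of `U` there are `μ` many that have a
common pseudo-intersection in `U`. -/
def GalStar {κ : Cardinal.{u}} (U : Ultrafilter (CardSet κ)) (μ ν : Cardinal.{u}) : Prop :=
  ∀ A : CardSet ν → Set (CardSet κ), Function.Injective A → (∀ i, A i ∈ U) →
    ∃ I : Set (CardSet ν), #I = μ ∧ ∃ X ∈ U, ∀ i ∈ I, AlmostSubset X (A i)

/-- `P ≤_T Q`: there is a map from `Q` to `P` sending cofinal subsets of `Q` to cofinal subsets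
of `P`. -/
def TukeyLE (P Q : Type u) [Preorder P] [Preorder Q] : Prop :=
  ∃ f : Q → P, ∀ X : Set Q, IsCofinal X → IsCofinal (f '' X)

/-- `P ≡_T Q`. -/
def TukeyEquiv (P Q : Type u) [Preorder P] [Preorder Q] : Prop :=
  TukeyLE P Q ∧ TukeyLE Q P

/-- The members of `U`, to be ordered by `⊇*`. -/
structure AlmostOrdered {K : Type u} (U : Ultrafilter K) : Type u where
  carrier : Set K
  mem : carrier ∈ U

/-- The preorder `⊇*` on `U`: `X ≤ Y` means `Y ⊆* X`. -/
instance AlmostOrdered.instPreorder {K : Type u} [LinearOrder K] (U : Ultrafilter K) :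
    Preorder (AlmostOrdered U) where
  le X Y := AlmostSubset Y.carrier X.carrier
  le_refl X := by
    obtain ⟨a, -⟩ := Filter.nonempty_of_mem X.mem
    exact ⟨a, fun x hx => absurd hx.1 hx.2⟩
  le_trans X Y Z hXY hYZ := by
    obtain ⟨a, -⟩ := Filter.nonempty_of_mem X.mem
    have : Nonempty K := ⟨a⟩
    refine (BddAbove.union hXY hYZ).mono fun x hx => ?_
    by_cases h : x ∈ Y.carrier
    · exact Or.inl ⟨h, hx.2⟩
    · exact Or.inr ⟨hx.1, h⟩

/-- `[ν]^{<μ}`, the subsets of `ν` of cardinality less than `μ`, ordered by inclusion. -/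
abbrev SmallSubsets (ν μ : Cardinal.{u}) : Type u :=
  {s : Set (CardSet ν) // #s < μ}

/-! ### Compactness, clubs and cofinalities at a regular cardinal -/

section Regular

variable {κ : Cardinal.{u}}

/-! Take `2 ^ κ` sets `A i`, independent modulo the club filter. Let `U` extend the clubs, the `A
i`, and the complement of every set almost contained in `κ` many `A i`. Fewer than `κ` of these sets
meet: each such complement contains a tail of some `(A i)ᶜ` whose `A i` is not among the chosen
sets, so the intersection contains a club intersected with a stationary Boolean combination
(`sInter_nonempty_of_stationary_independent`). Clubs make `U` a uniform q-point. Each `X ∈ U` is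
almost contained in fewer than `κ` many `A i`; this refutes `GalStar`, and `X ↦ {i | X ⊆* A i}`
gives the nontrivial Tukey reduction. The family exists because compactness makes `κ` inaccessible:
a Hausdorff-type independent family is pulled back along a partition into `κ` stationary sets. -/

theorem exists_forall_lt_of_mk_lt (hreg : κ.IsRegular) {s : Set (CardSet κ)} (hs : #s < κ) :
    ∃ a, ∀ x ∈ s, x < a := by
  have := Cardinal.noMaxOrder hreg.aleph0_le
  have hb : BddAbove s := by
    refine .of_not_isCofinal fun h => (Order.cof_le h).not_gt ?_
    rwa [Ordinal.cof_toType, hreg.cof_ord]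
  obtain ⟨b, hb⟩ := hb
  obtain ⟨a, ha⟩ := exists_gt b
  exact ⟨a, fun x hx => (hb hx).trans_lt ha⟩

theorem mk_eq_of_forall_exists_lt (hreg : κ.IsRegular) {s : Set (CardSet κ)}
    (hs : ∀ a, ∃ x ∈ s, a < x) : #s = κ := by
  refine le_antisymm ((mk_set_le s).trans_eq (mk_ord_toType κ)) (not_lt.1 fun h => ?_)
  obtain ⟨a, ha⟩ := exists_forall_lt_of_mk_lt hreg h
  obtain ⟨x, hx, hax⟩ := hs a
  exact (ha x hx).asymm hax

theorem nonempty_cardSet (hreg : κ.IsRegular) : Nonempty (CardSet κ) := by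
  rw [← mk_ne_zero_iff, mk_ord_toType]
  exact hreg.ne_zero

theorem isRegularCardinalOrder_cardSet (hreg : κ.IsRegular) :
    IsRegularCardinalOrder (CardSet κ) where
  type_lt_le_ord_cof := by
    rw [Ordinal.cof_toType, hreg.cof_ord, Ordinal.type_toType]

theorem cof_cardSet (hreg : κ.IsRegular) : Order.cof (CardSet κ) = κ := by
  rw [Ordinal.cof_toType, hreg.cof_ord]

/-- A `κ`-complete ultrafilter over `κ` containing a given family all of whose subfamilies of
cardinality less than `κ` have nonempty intersection. -/
theorem IsSelfCompact.exists_ultrafilter (hreg : κ.IsRegular) (hcomp : IsSelfCompact κ)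
    (G : Set (Set (CardSet κ))) (hG : ∀ S ⊆ G, #S < κ → (⋂₀ S).Nonempty) :
    ∃ U : Ultrafilter (CardSet κ), CardinalInterFilter (U : Filter (CardSet κ)) κ ∧
      ∀ X ∈ G, X ∈ U := by
  obtain ⟨U, hle, hU⟩ := hcomp (Filter.cardinalGenerate G (hreg.nat_lt 2))
    (Filter.neBot_iff.2 fun h => by
      have : (∅ : Set (CardSet κ)) ∈ Filter.cardinalGenerate G (hreg.nat_lt 2) := by
        rw [h]; exact Filter.mem_bot
      rw [Filter.mem_cardinalGenerate_iff (hreg := hreg)] at this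
      obtain ⟨S, hSG, hS, hS0⟩ := this
      obtain ⟨x, hx⟩ := hG S hSG hS
      exact hS0 hx)
    (Filter.cardinalInter_ofCardinalGenerate _ _)
  exact ⟨U, hU, fun X hX => hle (Filter.CardinalGenerateSets.basic hX)⟩

/-- If `κ ≤ 2 ^ μ` with `μ < κ`, code points by distinct subsets of `μ`. A `κ`-complete ultrafilter
decides all `μ` coordinates at once, so it concentrates on at most one point, although it contains
all complements of singletons. -/
theorem IsSelfCompact.isInaccessible (hreg : κ.IsRegular) (hunc : ℵ₀ < κ)
    (hcomp : IsSelfCompact κ) : κ.IsInaccessible := by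
  refine isInaccessible_def.2 ⟨hunc, hreg, hreg.ne_zero, fun {μ} hμ => not_le.1 fun hκ => ?_⟩
  obtain ⟨U, hU, hUG⟩ := hcomp.exists_ultrafilter hreg (range fun x => ({x}ᶜ : Set (CardSet κ)))
    fun S hSG hS => by
      have hlt : #{x : CardSet κ | ({x}ᶜ : Set (CardSet κ)) ∈ S} < κ := by
        refine (mk_le_of_injective (f := fun x : {x : CardSet κ | ({x}ᶜ : Set (CardSet κ)) ∈ S} =>
          (⟨{x.1}ᶜ, x.2⟩ : S)) fun x y h => ?_).trans_lt hS
        simpa [Subtype.ext_iff] using h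
      obtain ⟨a, ha⟩ := exists_forall_lt_of_mk_lt hreg hlt
      refine ⟨a, fun X hX => ?_⟩
      obtain ⟨x, rfl⟩ := hSG hX
      exact (ha x hX).ne'
  have hemb : #(CardSet κ) ≤ #(Set μ.out) := by
    rw [mk_ord_toType, mk_set, mk_out]; exact hκ
  obtain ⟨e⟩ := hemb
  have hdec : ∀ a : μ.out, ∃ p : Prop, {x | a ∈ e x ↔ p} ∈ U := fun a => by
    rcases U.mem_or_compl_mem {x | a ∈ e x} with h | h
    · exact ⟨True, by simpa using h⟩
    · exact ⟨False, by simpa using! h⟩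
  choose p hp using hdec
  have hall : (⋂ a, {x | a ∈ e x ↔ p a}) ∈ (U : Filter (CardSet κ)) :=
    (Filter.cardinal_iInter_mem (c := κ) (by rwa [mk_out])).2 hp
  obtain ⟨x, hx⟩ := Filter.nonempty_of_mem hall
  obtain ⟨y, hy, hyx⟩ := Filter.nonempty_of_mem (Filter.inter_mem hall (hUG _ ⟨x, rfl⟩))
  refine hyx (e.injective (Set.ext fun a => ?_))
  exact (mem_iInter.1 hy a).trans (mem_iInter.1 hx a).symm

theorem isClub_Ioi (hreg : κ.IsRegular) (b : CardSet κ) : IsClub (Ioi b) := by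
  have := Cardinal.noMaxOrder hreg.aleph0_le
  refine ⟨fun s hs hs0 _ x hx => ?_, fun a => ?_⟩
  · obtain ⟨y, hy⟩ := hs0
    exact (hs hy : b < y).trans_le (hx.1 hy)
  · obtain ⟨c, hc⟩ := exists_gt (max a b)
    exact ⟨c, (le_max_right a b).trans_lt hc, (le_max_left a b).trans hc.le⟩

theorem isClub_closurePoints (hreg : κ.IsRegular) (hunc : ℵ₀ < κ) (g : CardSet κ → CardSet κ) :
    IsClub {d | ∀ a < d, g a < d} := by
  refine ⟨fun s hs _ _ x hx a ha => ?_, fun a => ?_⟩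
  · obtain ⟨y, hy, hay⟩ := (lt_isLUB_iff hx).1 ha
    exact (hs hy a hay).trans_le (hx.1 hy)
  · have hstep : ∀ b : CardSet κ, ∃ c, b < c ∧ ∀ x < b, g x < c := fun b => by
      obtain ⟨c, hc⟩ := exists_forall_lt_of_mk_lt hreg (s := insert b (g '' Iio b)) <| by
        refine (mk_insert_le).trans_lt (add_lt_of_lt hreg.aleph0_le
          (mk_image_le.trans_lt ?_) (hreg.nat_lt 1 |>.trans_eq' (by simp)))
        simpa using mk_Iio_lt b (by simp)
      exact ⟨c, hc b (mem_insert ..), fun x hx => hc _ (mem_insert_of_mem _ ⟨x, hx, rfl⟩)⟩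
    choose h hlt hg using hstep
    have hcount : #(range fun n : ℕ => h^[n] a) < κ :=
      ((countable_range _).le_aleph0).trans_lt hunc
    obtain ⟨b, hb⟩ := exists_forall_lt_of_mk_lt hreg hcount
    have hne : (upperBounds (range fun n : ℕ => h^[n] a)).Nonempty := ⟨b, fun x hx => (hb x hx).le⟩
    -- The supremum of the `ω` iterates is closed under `g`.
    obtain ⟨d, hd, hmin⟩ := WellFounded.has_min (wellFounded_lt (α := CardSet κ)) _ hne
    refine ⟨d, fun x hx => ?_, hd ⟨0, rfl⟩⟩
    obtain ⟨n, hn⟩ : ∃ n : ℕ, x < h^[n] a := by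
      by_contra! hcon
      exact hmin x (by rintro _ ⟨n, rfl⟩; exact hcon n) hx
    refine (hg _ x hn).trans_le (hd ⟨n + 1, ?_⟩)
    exact Function.iterate_succ_apply' h n a

end Regular

/-- A club set contains points of every cofinality realized by a limit point. -/
theorem IsClub.exists_cof_Iio_eq {α : Type u} [LinearOrder α] [WellFoundedLT α]
    [IsRegularCardinalOrder α] {C : Set α} (hC : IsClub C) {a : α} (ha : Order.IsSuccLimit a) :
    ∃ d ∈ C, Order.cof (Iio d) = Order.cof (Iio a) := by
  have hn := hC.isNormal_enum
  refine ⟨_, (Order.enum C hC.isCofinal a).2, ?_⟩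
  -- A normal function maps the points below a limit `a` cofinally below its value at `a`.
  refine (Order.cof_congr_of_strictMono (f := fun x : Iio a =>
    (⟨Order.enum C hC.isCofinal x, hn.strictMono x.2⟩ :
      Iio (Order.enum C hC.isCofinal a : α))) (fun x y h => hn.strictMono h) ?_).symm
  rintro ⟨b, hb⟩
  obtain ⟨c, hc, hbc⟩ := (hn.lt_iff_exists_lt ha).1 hb
  exact ⟨_, ⟨⟨c, hc⟩, rfl⟩, hbc.le⟩

theorem isSuccLimit_of_one_lt_cof_Iio {α : Type u} [LinearOrder α] {a : α}
    (ha : 1 < Order.cof (Iio a)) : Order.IsSuccLimit a := by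
  have hne : Nonempty (Iio a) := Order.cof_ne_zero_iff.1 (zero_lt_one.trans ha).ne'
  refine ⟨fun h => ?_, fun b hb => ?_⟩
  · obtain ⟨b, hb⟩ := hne
    exact h.not_lt hb
  · refine ha.ne' (Order.cof_eq_one_iff.2 ⟨⟨b, hb.lt⟩, fun c => ?_⟩)
    exact not_lt.1 fun h => hb.2 h c.2

/-! ### Stationary partitions and independent families -/

section Inaccessible

variable {κ : Cardinal.{u}}

/-- An inaccessible `κ` is partitioned into `κ` many stationary sets. -/
theorem Cardinal.IsInaccessible.exists_stationary_fibres (hκ : κ.IsInaccessible) :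
    ∃ c : CardSet κ → CardSet κ, ∀ x, IsStationary (c ⁻¹' {x}) := by
  have hreg := hκ.isRegular
  have := isRegularCardinalOrder_cardSet hreg
  have := nonempty_cardSet hreg
  -- Successor alephs are regular, hence are their own cofinalities; since `ℵ_κ = κ`, all those used
  -- here lie below `κ`.
  let r : CardSet κ → Cardinal.{u} := fun x => ℵ_ ((x.toOrd : Ordinal) + 1)
  have hr : Function.Injective r := fun x y h => by
    exact Ordinal.ToType.mk.symm.injective (Subtype.ext (by simpa [r] using h))
  refine ⟨fun d => Function.invFun r (Order.cof (Iio d)), fun x C hC => ?_⟩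
  have hlt : (r x).ord < κ.ord := by
    rw [ord_lt_ord, ← hκ.aleph_ord, aleph_lt_aleph]
    exact (isSuccLimit_ord hreg.aleph0_le).add_one_lt x.toOrd.2
  let a : CardSet κ := Ordinal.ToType.mk ⟨(r x).ord, hlt⟩
  have ha : Order.cof (Iio a) = r x := by
    have htype : Ordinal.typein (α := CardSet κ) (· < ·) a = (r x).ord := by
      exact Ordinal.typein_enum _ _
    rw [Order.cof_Iio, htype]
    exact (isRegular_aleph_add_one _).cof_ord
  obtain ⟨d, hd, hda⟩ := hC.exists_cof_Iio_eq (isSuccLimit_of_one_lt_cof_Iio (a := a) (by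
    rw [ha]; exact one_lt_aleph0.trans_le (aleph0_le_aleph _)))
  refine ⟨d, ?_, hd⟩
  simp only [mem_preimage, mem_singleton_iff, hda, ha]
  exact Function.leftInverse_invFun hr x

/-- A strong limit regular `κ` carries a `κ`-independent family indexed by its subsets. -/
theorem Cardinal.IsInaccessible.exists_independent_family (hκ : κ.IsInaccessible) :
    ∃ B : Set (CardSet κ) → Set (CardSet κ), ∀ s t : Set (Set (CardSet κ)),
      #s < κ → #t < κ → Disjoint s t → ∃ x, (∀ X ∈ s, x ∈ B X) ∧ ∀ X ∈ t, x ∉ B X := by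
  have hreg := hκ.isRegular
  have hcard : #(Σ a : CardSet κ, Set (Set (Iio a))) ≤ #(CardSet κ) := by
    rw [mk_sigma]
    refine (sum_le_sum _ (fun _ => κ) fun a => ?_).trans ?_
    · have hlt : #(Iio a) < κ := by simpa using mk_Iio_lt a (by simp)
      rw [mk_set, mk_set]
      exact (hκ.isStrongPrelimit (hκ.isStrongPrelimit hlt)).le
    · simp [mul_eq_self hreg.aleph0_le]
  obtain ⟨e⟩ := hcard
  -- Points code pairs of some `a` and a family of subsets of `Iio a`; `B X` holds the codes whose
  -- family contains the trace of `X`.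
  refine ⟨fun X => e '' {j | (Subtype.val ⁻¹' X : Set (Iio j.1)) ∈ j.2}, fun s t hs ht hst => ?_⟩
  have hdiff : ∀ p : s × t, ∃ d : CardSet κ, ¬ (d ∈ p.1.1 ↔ d ∈ p.2.1) := fun p => by
    by_contra! hcon
    exact disjoint_left.1 hst p.1.2 (Set.ext hcon ▸ p.2.2)
  choose d hd using hdiff
  -- Below this `a`, members of `s` and of `t` already have different traces.
  obtain ⟨a, ha⟩ := exists_forall_lt_of_mk_lt hreg (s := range d) <|
    mk_range_le.trans_lt <| by
      rw [mk_prod, lift_id, lift_id]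
      exact mul_lt_of_lt hreg.aleph0_le hs ht
  refine ⟨e ⟨a, (fun X => Subtype.val ⁻¹' X) '' s⟩, fun X hX => ⟨⟨a, _⟩, mem_image_of_mem _ hX, rfl⟩, ?_⟩
  rintro Y hY ⟨j, hj, hje⟩
  obtain rfl := e.injective hje
  obtain ⟨X, hX, hXY⟩ := hj
  refine hd (⟨X, hX⟩, ⟨Y, hY⟩) ?_
  exact Set.ext_iff.1 hXY ⟨d (⟨X, hX⟩, ⟨Y, hY⟩), ha _ ⟨_, rfl⟩⟩

/-- There is a family of `2 ^ κ` sets which is `κ`-independent modulo the club filter. -/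
theorem Cardinal.IsInaccessible.exists_stationary_independent_family (hκ : κ.IsInaccessible) :
    ∃ A : CardSet (2 ^ κ) → Set (CardSet κ), ∀ s t : Set (CardSet (2 ^ κ)),
      #s < κ → #t < κ → Disjoint s t →
        IsStationary {x | (∀ i ∈ s, x ∈ A i) ∧ ∀ i ∈ t, x ∉ A i} := by
  obtain ⟨c, hc⟩ := hκ.exists_stationary_fibres
  obtain ⟨B, hB⟩ := hκ.exists_independent_family
  obtain ⟨e⟩ : Nonempty (CardSet (2 ^ κ) ≃ Set (CardSet κ)) := by
    rw [← Cardinal.eq, mk_set, mk_ord_toType, mk_ord_toType]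
  refine ⟨fun i => c ⁻¹' B (e i), fun s t hs ht hst => ?_⟩
  obtain ⟨x, hxs, hxt⟩ := hB (e '' s) (e '' t) (mk_image_le.trans_lt hs) (mk_image_le.trans_lt ht)
    ((disjoint_image_iff e.injective).2 hst)
  -- The whole fibre of colour `x` lies in the Boolean combination.
  refine (hc x).mono ?_
  rintro y rfl
  exact ⟨fun i hi => hxs _ ⟨i, hi, rfl⟩, fun i hi => hxt _ ⟨i, hi, rfl⟩⟩

end Inaccessible

/-! ### Consequences for the ultrafilter -/

section Ultrafilter

variable {κ : Cardinal.{u}} {U : Ultrafilter (CardSet κ)}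

theorem isUniformUltrafilter_of_club_mem (hreg : κ.IsRegular) (hU : ∀ C, IsClub C → C ∈ U) :
    IsUniformUltrafilter U := fun _ hX =>
  mk_eq_of_forall_exists_lt hreg fun a =>
    Filter.nonempty_of_mem (Filter.inter_mem hX (hU _ (isClub_Ioi hreg a)))

/-- An ultrafilter extending the club filter is a q-point. -/
theorem isQPoint_of_club_mem (hreg : κ.IsRegular) (hunc : ℵ₀ < κ)
    (hU : ∀ C, IsClub C → C ∈ U) : IsQPoint U := by
  rintro f ⟨X, hX, hf⟩
  choose b hb using fun c => exists_forall_lt_of_mk_lt hreg (hf c)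
  have hC := hU _ (isClub_closurePoints hreg hunc fun a => b (f a))
  -- A repeated value would give `y < b (f x)` by the choice of `b`, and `b (f x) < y` since `y` is
  -- a closure point.
  have key : ∀ x ∈ X, ∀ y ∈ X ∩ {d | ∀ a < d, b (f a) < d}, x < y → f x ≠ f y :=
    fun x _ y hy hxy h => (hy.2 x hxy).asymm (hb (f x) y ⟨hy.1, h.symm⟩)
  refine ⟨_, Filter.inter_mem hX hC, fun x hx y hy h => ?_⟩
  by_contra hne
  rcases lt_or_gt_of_ne hne with hlt | hlt
  · exact key x hx.1 y hy hlt h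
  · exact key y hy.1 x hx hlt h.symm

theorem not_galStar_of_mk_lt {μ ν : Cardinal.{u}} {A : CardSet ν → Set (CardSet κ)}
    (hinj : Function.Injective A) (hA : ∀ i, A i ∈ U)
    (hlt : ∀ X ∈ U, #{i | AlmostSubset X (A i)} < μ) : ¬ GalStar U μ ν := by
  intro h
  obtain ⟨I, hI, X, hX, hXI⟩ := h A hinj hA
  exact (hlt X hX).not_ge (hI.symm.trans_le (mk_le_mk_of_subset hXI))

theorem almostOrdered_le_of_subset {X Y : AlmostOrdered U} (h : Y.carrier ⊆ X.carrier) :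
    X ≤ Y := by
  obtain ⟨a, -⟩ := Filter.nonempty_of_mem X.mem
  exact ⟨a, fun x hx => absurd (h hx.1) hx.2⟩

theorem tukeyLE_of_monotone {P Q : Type u} [Preorder P] [Preorder Q] (f : Q → P)
    (hf : Monotone f) (hcof : IsCofinal (range f)) : TukeyLE P Q := by
  refine ⟨f, fun X hX p => ?_⟩
  obtain ⟨_, ⟨q, rfl⟩, hq⟩ := hcof p
  obtain ⟨x, hx, hqx⟩ := hX q
  exact ⟨f x, ⟨x, hx, rfl⟩, hq.trans (hf hqx)⟩

theorem tukeyLE_smallSubsets (hreg : κ.IsRegular)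
    [CardinalInterFilter (U : Filter (CardSet κ)) κ] :
    TukeyLE (AlmostOrdered U) (SmallSubsets (2 ^ κ) κ) := by
  obtain ⟨e⟩ : Nonempty (CardSet (2 ^ κ) ≃ Set (CardSet κ)) := by
    rw [← Cardinal.eq, mk_set, mk_ord_toType, mk_ord_toType]
  let f : SmallSubsets (2 ^ κ) κ → AlmostOrdered U := fun s =>
    ⟨⋂₀ {X | X ∈ U ∧ e.symm X ∈ s.1}, (cardinal_sInter_mem
      ((mk_le_of_injective (f := fun X : {X | X ∈ U ∧ e.symm X ∈ s.1} =>
        (⟨e.symm X.1, X.2.2⟩ : s.1)) fun X Y h => by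
          simpa [Subtype.ext_iff] using h).trans_lt s.2)).2 fun X hX => hX.1⟩
  refine tukeyLE_of_monotone f (fun s t hst => ?_) fun X => ?_
  · exact almostOrdered_le_of_subset (sInter_subset_sInter fun X hX => ⟨hX.1, hst hX.2⟩)
  · refine ⟨_, ⟨⟨{e.symm X.carrier}, ?_⟩, rfl⟩, almostOrdered_le_of_subset ?_⟩
    · rw [mk_singleton]
      exact_mod_cast hreg.nat_lt 1
    · exact sInter_subset_of_mem ⟨X.mem, rfl⟩

/-- The range is cofinal by `κ`-completeness: `s` lies below the image of the intersection of the `A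
i` with `i ∈ s`. -/
theorem smallSubsets_tukeyLE {ν : Cardinal.{u}} {A : CardSet ν → Set (CardSet κ)}
    [CardinalInterFilter (U : Filter (CardSet κ)) κ] (hA : ∀ i, A i ∈ U)
    (hlt : ∀ X ∈ U, #{i | AlmostSubset X (A i)} < κ) :
    TukeyLE (SmallSubsets ν κ) (AlmostOrdered U) := by
  refine tukeyLE_of_monotone (fun X => ⟨{i | AlmostSubset X.carrier (A i)}, hlt _ X.mem⟩)
    (fun X Y hXY i hi => ?_) fun s => ?_
  · exact le_trans (a := (⟨A i, hA i⟩ : AlmostOrdered U)) (b := X) (c := Y) hi hXY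
  · let X : AlmostOrdered U := ⟨⋂ i ∈ s.1, A i,
      (Filter.cardinal_bInter_mem s.2).2 fun i _ => hA i⟩
    refine ⟨_, ⟨X, rfl⟩, fun i hi => ?_⟩
    exact almostOrdered_le_of_subset (X := ⟨A i, hA i⟩) (Y := X) (biInter_subset_of_mem hi)

end Ultrafilter

/-! ### Construction of the ultrafilter -/

/-- The club sets, the members of a family `κ`-independent modulo the club filter, and the
complements of the pseudo-intersections of `κ` many of its members generate a proper `κ`-complete
filter. -/
theorem sInter_nonempty_of_stationary_independent {κ : Cardinal.{u}} (hreg : κ.IsRegular)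
    (hunc : ℵ₀ < κ) {A : CardSet (2 ^ κ) → Set (CardSet κ)} (hinj : Function.Injective A)
    (hA : ∀ s t : Set (CardSet (2 ^ κ)), #s < κ → #t < κ → Disjoint s t →
      IsStationary {x | (∀ i ∈ s, x ∈ A i) ∧ ∀ i ∈ t, x ∉ A i})
    {S : Set (Set (CardSet κ))} (hS : #S < κ)
    (hSG : ∀ Y ∈ S, IsClub Y ∨ Y ∈ range A ∨ κ ≤ #{i | AlmostSubset Yᶜ (A i)}) :
    (⋂₀ S).Nonempty := by
  let s : Set (CardSet (2 ^ κ)) := A ⁻¹' S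
  have hs : #s < κ := (mk_preimage_of_injective A S hinj).trans_lt hS
  have hex : ∀ I : Set (CardSet (2 ^ κ)), κ ≤ #I → ∃ i ∈ I, i ∉ s := fun I hI => by
    by_contra! hcon
    exact (hI.trans (mk_le_mk_of_subset hcon)).not_gt hs
  have huniv : κ ≤ #(univ : Set (CardSet (2 ^ κ))) := by
    rw [mk_univ, mk_ord_toType]
    exact (cantor κ).le
  -- Only the third kind of generator needs `i`; for the other two it is a dummy index outside `s`.
  have hY : ∀ Y : S, ∃ i ∉ s, ∃ C, IsClub C ∧
      ∀ d ∈ C, (∀ j ∈ s, d ∈ A j) → d ∉ A i → d ∈ Y.1 := by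
    rintro ⟨Y, hYS⟩
    rcases hSG Y hYS with h | ⟨j, rfl⟩ | h
    · obtain ⟨i, -, hi⟩ := hex _ huniv
      exact ⟨i, hi, Y, h, fun d hd _ _ => hd⟩
    · obtain ⟨i, -, hi⟩ := hex _ huniv
      exact ⟨i, hi, univ, .univ, fun d _ hd _ => hd j hYS⟩
    · obtain ⟨i, ⟨b, hb⟩, hi⟩ := hex _ h
      refine ⟨i, hi, Ioi b, isClub_Ioi hreg b, fun d hd _ hdi => ?_⟩
      by_contra hdY
      exact (hb ⟨hdY, hdi⟩).not_gt hd
  choose i hi C hC hCY using hY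
  have hclub : IsClub (⋂ Y, C Y) := by
    refine .iInter ?_ ?_ hC
    · rw [cof_cardSet hreg]; exact hunc.ne'
    · rw [cof_cardSet hreg, lift_id, lift_id]; exact hS
  obtain ⟨d, ⟨hds, hdt⟩, hdC⟩ := hA s (range i) hs (mk_range_le.trans_lt hS)
    (disjoint_right.2 (by rintro _ ⟨Y, rfl⟩; exact hi Y)) hclub
  exact ⟨d, fun Y hY => hCY ⟨Y, hY⟩ d (mem_iInter.1 hdC _) hds (hdt _ ⟨_, rfl⟩)⟩

theorem theorem3p17 (κ : Cardinal.{u}) (hreg : κ.IsRegular) (hunc : ℵ₀ < κ)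
    (hcomp : IsSelfCompact κ) :
    ∃ U : Ultrafilter (CardSet κ),
      CardinalInterFilter (U : Filter (CardSet κ)) κ ∧
      IsUniformUltrafilter U ∧
      IsQPoint U ∧
      ¬ GalStar U κ (2 ^ κ) ∧
      TukeyEquiv (AlmostOrdered U) (SmallSubsets (2 ^ κ) κ) := by
  have hκ := hcomp.isInaccessible hreg hunc
  obtain ⟨A, hA⟩ := hκ.exists_stationary_independent_family
  have hone : (1 : Cardinal.{u}) < κ := by exact_mod_cast hreg.nat_lt 1
  have hinj : Function.Injective A := fun i j hij => by
    by_contra hne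
    obtain ⟨x, ⟨hxi, hxj⟩⟩ := (hA {i} {j} (by rwa [mk_singleton]) (by rwa [mk_singleton])
      (disjoint_singleton.2 hne)).nonempty
    exact hxj j rfl (hij ▸ hxi i rfl)
  obtain ⟨U, hU, hUG⟩ := hcomp.exists_ultrafilter hreg
    {Y | IsClub Y ∨ Y ∈ range A ∨ κ ≤ #{i | AlmostSubset Yᶜ (A i)}}
    fun S hSG hS => sInter_nonempty_of_stationary_independent hreg hunc hinj hA hS hSG
  have hclub : ∀ C, IsClub C → C ∈ U := fun C hC => hUG C (.inl hC)
  have hAU : ∀ i, A i ∈ U := fun i => hUG _ (.inr (.inl ⟨i, rfl⟩))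
  have hlt : ∀ X ∈ U, #{i | AlmostSubset X (A i)} < κ := fun X hX => not_le.1 fun h =>
    Ultrafilter.compl_notMem_iff.2 hX (hUG _ (.inr (.inr (by rwa [compl_compl]))))
  exact ⟨U, hU, isUniformUltrafilter_of_club_mem hreg hclub,
    isQPoint_of_club_mem hreg hunc hclub, not_galStar_of_mk_lt hinj hAU hlt,
    tukeyLE_smallSubsets hreg, smallSubsets_tukeyLE hAU hlt⟩
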